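/- Let $k$ be a field, let $\mathcal I$ be a finite set (of cells), and let $A$ be a $d\times|\mathcal I|$ integer matrix with columns $a_i\in\mathbb Z^d$ $(i\in\mathcal I)$. Assume that $A$ is homogeneous, i.e. there is a vector $w\in\mathbb R^d$ with $w^{\top}a_i=1$ for all $i\in\mathcal I$. Let $I_A\subseteq k[u]=k[u_i: i\in\mathcal I]$ be the toric ideal of $A$, that is, the kernel of the $k$-algebra homomorphism $k[u]\to k[t_1^{\pm1},\dots,t_d^{\pm1}]$, $u_i\mapsto t^{a_i}$. A system of binomial generators of $I_A$ is a set of binomials of the form $u^{z^+}-u^{z^-}$, with $z\in\mathbb Z^{\mathcal I}$, $Az=0$, and $z^+,z^-$ the positive and negative parts of $z$, that generates the ideal $I_A$. A monomial $u^x$, $x\in\mathbb N^{\mathcal I}$, is called indispensable if every system of binomial generators of $I_A$ contains a binomial $f$ such that $u^x$ is a term of $f$. **Theorem.** Let $x\in\mathbb N^{\mathcal I}$. Suppose that for every lexicographic term order on $k[u]$ (one for each ordering of the variables) the reduced Gröbner basis of $I_A$ with respect to this order contains an element of which $u^x$ is a term. Then the monomial $u^x$ is indispensable. -/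

import Mathlib

open scoped MonomialOrder

/-! ### Gröbner bases -/

section Groebner

/-- `G` is a Gröbner basis of the ideal `I` with respect to the monomial order `m`: a finite subset
of `I` whose leading terms generate the initial ideal of `I`. -/
structure IsGroebnerBasis {σ k : Type*} [Field k] (m : MonomialOrder σ)
    (I : Ideal (MvPolynomial σ k)) (G : Set (MvPolynomial σ k)) : Prop where
  finite : G.Finite
  subset : G ⊆ (I : Set (MvPolynomial σ k))
  span_leadingTerm : Ideal.span (m.leadingTerm '' G) =
    Ideal.span (m.leadingTerm '' (I : Set (MvPolynomial σ k)))

/-- `G` is a reduced Gröbner basis of `I`: a Gröbner basis, all of whose elements are monic, such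
that no monomial occurring in an element `g` of `G` is divisible by the leading monomial of another
element of `G`. -/
structure IsReducedGroebnerBasis {σ k : Type*} [Field k] (m : MonomialOrder σ)
    (I : Ideal (MvPolynomial σ k)) (G : Set (MvPolynomial σ k)) : Prop
    extends IsGroebnerBasis m I G where
  monic : ∀ g ∈ G, m.Monic g
  reduced : ∀ g ∈ G, ∀ h ∈ G, h ≠ g → ∀ a ∈ g.support, ¬ m.degree h ≤ a

/-- For a set of monic polynomials of `I`, generating the initial ideal means that the leading
monomial of each nonzero element of `I` is divisible by the leading monomial of some member. -/
theorem span_leadingTerm_eq_iff_of_monic {σ k : Type*} [Field k] (m : MonomialOrder σ)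
    {I : Ideal (MvPolynomial σ k)} {G : Set (MvPolynomial σ k)}
    (hG : G ⊆ (I : Set (MvPolynomial σ k))) (hm : ∀ g ∈ G, m.Monic g) :
    Ideal.span (m.leadingTerm '' G) =
      Ideal.span (m.leadingTerm '' (I : Set (MvPolynomial σ k))) ↔
    ∀ f ∈ I, f ≠ 0 → ∃ g ∈ G, m.degree g ≤ m.degree f := by
  classical
  have key : Ideal.span (m.leadingTerm '' G) =
      Ideal.span ((fun s => MvPolynomial.monomial s (1 : k)) '' (m.degree '' G)) := by
    rw [m.span_leadingTerm_eq_span_monomial (fun g hg => by rw [hm g hg]; exact isUnit_one),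
      Set.image_image]
  constructor
  · intro h f hf hf0
    have h1 : m.leadingTerm f ∈ Ideal.span (m.leadingTerm '' G) := by
      rw [h]; exact Ideal.subset_span ⟨f, hf, rfl⟩
    rw [key, MvPolynomial.mem_ideal_span_monomial_image] at h1
    have h2 : m.degree f ∈ (m.leadingTerm f).support := by
      rw [MvPolynomial.mem_support_iff, MonomialOrder.leadingTerm, MvPolynomial.coeff_monomial,
        if_pos rfl]
      exact m.leadingCoeff_ne_zero_iff.2 hf0
    obtain ⟨_, ⟨g, hg, rfl⟩, hle⟩ := h1 _ h2
    exact ⟨g, hg, hle⟩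
  · intro h
    apply le_antisymm
    · exact Ideal.span_mono (Set.image_mono hG)
    · rw [key, Ideal.span_le]
      rintro _ ⟨f, hf, rfl⟩
      rw [SetLike.mem_coe, MvPolynomial.mem_ideal_span_monomial_image]
      intro a ha
      have ha' : a = m.degree f ∧ f ≠ 0 := by
        classical
        rw [MvPolynomial.mem_support_iff, MonomialOrder.leadingTerm,
          MvPolynomial.coeff_monomial] at ha
        split_ifs at ha with h3
        · exact ⟨h3.symm, m.leadingCoeff_ne_zero_iff.1 ha⟩
        · exact absurd rfl ha
      obtain ⟨g, hg, hle⟩ := h f hf ha'.2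
      exact ⟨_, ⟨g, hg, rfl⟩, ha'.1 ▸ hle⟩

theorem IsReducedGroebnerBasis.exists_degree_le {σ k : Type*} [Field k] {m : MonomialOrder σ}
    {I : Ideal (MvPolynomial σ k)} {G : Set (MvPolynomial σ k)}
    (hG : IsReducedGroebnerBasis m I G) {f : MvPolynomial σ k} (hf : f ∈ I) (hf0 : f ≠ 0) :
    ∃ g ∈ G, m.degree g ≤ m.degree f :=
  (span_leadingTerm_eq_iff_of_monic m hG.subset hG.monic).1 hG.span_leadingTerm f hf hf0

theorem IsReducedGroebnerBasis.subset_of_same {σ k : Type*} [Field k] {m : MonomialOrder σ}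
    {I : Ideal (MvPolynomial σ k)} {G H : Set (MvPolynomial σ k)}
    (hG : IsReducedGroebnerBasis m I G) (hH : IsReducedGroebnerBasis m I H) : G ⊆ H := by
  intro g hg
  have hg0 : g ≠ 0 := (hG.monic g hg).ne_zero
  obtain ⟨h, hh, hle⟩ := hH.exists_degree_le (hG.subset hg) hg0
  have hh0 : h ≠ 0 := (hH.monic h hh).ne_zero
  obtain ⟨g', hg', hle'⟩ := hG.exists_degree_le (hH.subset hh) hh0
  have hgg : g' = g := by
    by_contra hne
    exact hG.reduced g hg g' hg' hne _ (m.degree_mem_support hg0) (hle'.trans hle)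
  subst hgg
  have hdeg : m.degree h = m.degree g' := le_antisymm hle hle'
  suffices hs : g' - h = 0 by
    rw [sub_eq_zero.1 hs]; exact hh
  by_contra hne
  have hc := m.degree_mem_support hne
  set c := m.degree (g' - h) with hcdef
  have hcne : c ≠ m.degree g' := by
    intro hceq
    rw [hceq, MvPolynomial.mem_support_iff, MvPolynomial.coeff_sub, (hG.monic g' hg).coeff_degree,
      ← hdeg, (hH.monic h hh).coeff_degree, sub_self] at hc
    exact hc rfl
  have main : ∀ (K : Set (MvPolynomial σ k)) (q : MvPolynomial σ k), IsReducedGroebnerBasis m I K →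
      q ∈ K → m.degree q = m.degree g' → c ∉ q.support := by
    intro K q hK hq hqd hcq
    obtain ⟨q', hq', hq'le⟩ := hK.exists_degree_le (I.sub_mem (hG.subset hg) (hH.subset hh)) hne
    have : q' = q := by
      by_contra hne'
      exact hK.reduced q hq q' hq' hne' c hcq hq'le
    subst this
    apply hcne
    apply m.toSyn.injective
    apply le_antisymm
    · rw [← hqd]; exact m.le_degree hcq
    · rw [← hqd]; exact m.toSyn_monotone hq'le
  rw [MvPolynomial.mem_support_iff, MvPolynomial.coeff_sub,
    MvPolynomial.notMem_support_iff.1 (main G g' hG hg rfl),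
    MvPolynomial.notMem_support_iff.1 (main H h hH hh hdeg), sub_zero] at hc
  exact hc rfl

/-- Normal form of a leading monomial: a monic element of `I` with leading exponent `a`, all of
whose other exponents are not leading exponents of elements of `I`. -/
theorem exists_monic_normal {σ k : Type*} [Field k] (m : MonomialOrder σ)
    (I : Ideal (MvPolynomial σ k)) (a : σ →₀ ℕ) (ha : ∃ f ∈ I, f ≠ 0 ∧ m.degree f = a) :
    ∃ g ∈ I, m.Monic g ∧ m.degree g = a ∧
      ∀ c ∈ g.support, c ≠ a → ∀ f ∈ I, f ≠ 0 → ¬ m.degree f ≤ c := by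
  classical
  let B : Set (MvPolynomial σ k) := {f | f ∈ I ∧ f ≠ 0}
  obtain ⟨q, r, hqr, hdeg, hr⟩ := m.div_set (B := B)
    (fun b hb => (m.leadingCoeff_ne_zero_iff.2 hb.2).isUnit) (MvPolynomial.monomial a (1 : k))
  have hda : m.degree (MvPolynomial.monomial a (1 : k)) = a := by
    rw [m.degree_monomial, if_neg one_ne_zero]
  set g := Finsupp.linearCombination (MvPolynomial σ k)
    (fun b : B => (b : MvPolynomial σ k)) q with hgdef
  have hgI : g ∈ I := by
    rw [hgdef, Finsupp.linearCombination_apply, Finsupp.sum]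
    exact I.sum_mem fun b _ => I.mul_mem_left _ b.2.1
  have hgle : m.degree g ≼[m] a := by
    rw [hgdef, Finsupp.linearCombination_apply, Finsupp.sum]
    refine m.degree_sum_le.trans (Finset.sup_le fun b _ => ?_)
    have := hdeg b
    rw [hda, mul_comm] at this
    exact this
  have har : a ∉ r.support := by
    obtain ⟨f, hf, hf0, hfa⟩ := ha
    exact fun h => hr a h f ⟨hf, hf0⟩ hfa.le
  have hga : g.coeff a = 1 := by
    have := congrArg (MvPolynomial.coeff a) hqr
    rw [MvPolynomial.coeff_monomial, if_pos rfl, MvPolynomial.coeff_add,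
      MvPolynomial.notMem_support_iff.1 har, add_zero] at this
    exact this.symm
  have hgd : m.degree g = a := by
    apply m.toSyn.injective
    apply le_antisymm hgle
    apply m.le_degree
    rw [MvPolynomial.mem_support_iff, hga]
    exact one_ne_zero
  refine ⟨g, hgI, ?_, hgd, ?_⟩
  · rw [MonomialOrder.Monic, MonomialOrder.leadingCoeff, hgd, hga]
  · intro c hc hca f hf hf0
    apply hr c _ f ⟨hf, hf0⟩
    have := congrArg (MvPolynomial.coeff c) hqr
    rw [MvPolynomial.coeff_monomial, if_neg (Ne.symm hca), MvPolynomial.coeff_add] at this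
    rw [MvPolynomial.mem_support_iff] at hc ⊢
    intro h0
    rw [h0, add_zero] at this
    exact hc this.symm

theorem existsUnique_isReducedGroebnerBasis {σ k : Type*} [Finite σ] [Field k]
    (m : MonomialOrder σ) (I : Ideal (MvPolynomial σ k)) :
    ∃! G : Set (MvPolynomial σ k), IsReducedGroebnerBasis m I G := by
  classical
  suffices hex : ∃ G : Set (MvPolynomial σ k), IsReducedGroebnerBasis m I G by
    obtain ⟨G, hG⟩ := hex
    exact ⟨G, hG, fun H hH => (hH.subset_of_same hG).antisymm (hG.subset_of_same hH)⟩
  let P : (σ →₀ ℕ) → Prop := fun a => ∃ f ∈ I, f ≠ 0 ∧ m.degree f = a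
  let M : Set (σ →₀ ℕ) := {a | Minimal P a}
  have hanti : IsAntichain (· ≤ ·) M := setOfPred_minimal_antichain P
  have hfin : M.Finite := hanti.finite_of_partiallyWellOrderedOn (Set.isPWO_of_wellQuasiOrderedLE M)
  choose! G hGI hGm hGd hGr using fun a (ha : P a) => exists_monic_normal m I a ha
  have hsub : G '' M ⊆ (I : Set (MvPolynomial σ k)) := by
    rintro _ ⟨a, ha, rfl⟩
    exact hGI a ha.prop
  have hmon : ∀ g ∈ G '' M, m.Monic g := by
    rintro _ ⟨a, ha, rfl⟩
    exact hGm a ha.prop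
  refine ⟨G '' M, ⟨hfin.image G, hsub, ?_⟩, hmon, ?_⟩
  · rw [span_leadingTerm_eq_iff_of_monic m hsub hmon]
    intro f hf hf0
    obtain ⟨b, hb, hbm⟩ := exists_minimal_le_of_wellFoundedLT P (m.degree f) ⟨f, hf, hf0, rfl⟩
    exact ⟨G b, ⟨b, hbm, rfl⟩, by rw [hGd b hbm.prop]; exact hb⟩
  · rintro _ ⟨a, ha, rfl⟩ _ ⟨b, hb, rfl⟩ hne c hc hle
    by_cases hca : c = a
    · subst hca
      rw [hGd b hb.prop] at hle
      have : b = c := le_antisymm hle (ha.le_of_le hb.prop hle)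
      exact hne (by rw [this])
    · exact hGr a ha.prop c hc hca (G b) (hGI b hb.prop) (hGm b hb.prop).ne_zero hle

/-- The reduced Gröbner basis of `I` with respect to `m`. -/
noncomputable def reducedGroebnerBasis {σ k : Type*} [Finite σ] [Field k]
    (m : MonomialOrder σ) (I : Ideal (MvPolynomial σ k)) : Set (MvPolynomial σ k) :=
  (existsUnique_isReducedGroebnerBasis m I).choose

theorem reducedGroebnerBasis_spec {σ k : Type*} [Finite σ] [Field k]
    (m : MonomialOrder σ) (I : Ideal (MvPolynomial σ k)) :
    IsReducedGroebnerBasis m I (reducedGroebnerBasis m I) :=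
  (existsUnique_isReducedGroebnerBasis m I).choose_spec.1

/-- The lexicographic term order on the monomials in the variables `σ` that is attached to an
ordering `o` of the variables. The lexicographic term orders on `k[u]` are those obtained from all
orderings `o` of the variables. -/
noncomputable def lexTermOrder {σ : Type*} [Finite σ] (o : LinearOrder σ) : MonomialOrder σ :=
  @MonomialOrder.lex σ o _

end Groebner

/-! ### Toric ideals -/

section Toric

/-- The toric ideal of the integer matrix `A` with columns `a i`: the kernel of the `k`-algebra
homomorphism `k[u] → k[t₁^{±1}, …, t_d^{±1}]`, `u i ↦ t ^ (a i)`. The Laurent polynomial ring is the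
group algebra of `ℤ ^ d`. -/
noncomputable def toricIdeal (k : Type*) [Field k] {d : ℕ} {ι : Type*}
    (A : Matrix (Fin d) ι ℤ) : Ideal (MvPolynomial ι k) :=
  RingHom.ker (MvPolynomial.aeval (R := k)
    (fun i : ι => (AddMonoidAlgebra.single (fun j => A j i) 1 : AddMonoidAlgebra k (Fin d → ℤ))))

/-- The standing homogeneity assumption: some `w` satisfies `w ⬝ a i = 1` for all columns `a i`. -/
def IsHomogeneousConfig {d : ℕ} {ι : Type*} (A : Matrix (Fin d) ι ℤ) : Prop :=
  ∃ w : Fin d → ℝ, ∀ i, ∑ j, w j * (A j i : ℝ) = 1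

/-- A move for `A`: an integer vector in the kernel of `A`. -/
def IsMove {d : ℕ} {ι : Type*} [Fintype ι] (A : Matrix (Fin d) ι ℤ) (z : ι → ℤ) : Prop :=
  A.mulVec z = 0

/-- The exponent vector `z⁺`, with entries `max (z i) 0`; so `z⁻` is `posExponent (-z)`. -/
noncomputable def posExponent {ι : Type*} [Finite ι] (z : ι → ℤ) : ι →₀ ℕ :=
  Finsupp.equivFunOnFinite.symm fun i => (z i).toNat

/-- The binomial `u ^ z⁺ - u ^ z⁻`. -/
noncomputable def moveBinomial (k : Type*) [Field k] {ι : Type*} [Finite ι] (z : ι → ℤ) :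
    MvPolynomial ι k :=
  MvPolynomial.monomial (posExponent z) 1 - MvPolynomial.monomial (posExponent (-z)) 1

/-- A system of binomial generators of the toric ideal of `A`: a set of binomials of moves that
generates the ideal. -/
structure IsBinomialGeneratingSystem {k : Type*} [Field k] {d : ℕ} {ι : Type*} [Fintype ι]
    (A : Matrix (Fin d) ι ℤ) (S : Set (MvPolynomial ι k)) : Prop where
  binomial : ∀ f ∈ S, ∃ z : ι → ℤ, IsMove A z ∧ f = moveBinomial k z
  span_eq : Ideal.span S = toricIdeal k A

/-- The monomial `u ^ x` is indispensable: every system of binomial generators of the toric ideal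
contains a binomial having `u ^ x` as a term. -/
def IsIndispensableMonomial (k : Type*) [Field k] {d : ℕ} {ι : Type*} [Fintype ι]
    (A : Matrix (Fin d) ι ℤ) (x : ι →₀ ℕ) : Prop :=
  ∀ S : Set (MvPolynomial ι k), IsBinomialGeneratingSystem A S → ∃ f ∈ S, x ∈ f.support

end Toric

/-! Call the fiber of `s` the set of exponents with the same `toricDegree`. If `s` shares its fiber
with some `t ≠ s`, homogeneity gives equal total degrees, so `t j < s j` for some `j`. A
lexicographic order with `j` greatest then makes `u ^ s` the leading term of `u ^ s - u ^ t`, which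
lies in the toric ideal. Terms of reduced Gröbner basis elements have no leading monomial as a
proper divisor (`not_degree_lt`), so every proper divisor of `u ^ x` is alone in its fiber. Terms of
elements of the ideal are never alone in their fibers. Hence some `u ^ x - u ^ y` with `y ≠ x` lies
in the ideal, and in any generating system some term `u ^ s` of a generator divides `u ^ x`. Since
`s` is not alone in its fiber, `s = x`. -/

/-- The degree of the monomial `u ^ s` in the grading by `ℤ ^ d` that is given by `A`. -/
def toricDegree {d : ℕ} {ι : Type*} [Fintype ι] (A : Matrix (Fin d) ι ℤ) (s : ι →₀ ℕ) :
    Fin d → ℤ :=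
  ∑ i, s i • fun j => A j i

theorem aeval_monomial_eq_single_toricDegree {k : Type*} [Field k] {d : ℕ} {ι : Type*} [Fintype ι]
    (A : Matrix (Fin d) ι ℤ) (s : ι →₀ ℕ) (c : k) :
    MvPolynomial.aeval (R := k)
      (fun i : ι => (AddMonoidAlgebra.single (fun j => A j i) 1 :
        AddMonoidAlgebra k (Fin d → ℤ))) (MvPolynomial.monomial s c) =
      AddMonoidAlgebra.single (toricDegree A s) c := by
  classical
  have key : ∀ t : Finset ι, ∏ i ∈ t, (AddMonoidAlgebra.single (fun j => A j i) 1 :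
      AddMonoidAlgebra k (Fin d → ℤ)) ^ s i =
      AddMonoidAlgebra.single (∑ i ∈ t, s i • fun j => A j i) 1 := by
    intro t
    induction t using Finset.induction_on with
    | empty => simp [AddMonoidAlgebra.one_def]
    | insert a t ha ih =>
      rw [Finset.prod_insert ha, Finset.sum_insert ha, ih, AddMonoidAlgebra.single_pow,
        AddMonoidAlgebra.single_mul_single, one_pow, one_mul]
  rw [MvPolynomial.aeval_monomial, Finsupp.prod_fintype _ _ (fun i => pow_zero _), key,
    AddMonoidAlgebra.coe_algebraMap]
  simp [AddMonoidAlgebra.single_mul_single, toricDegree]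

theorem monomial_sub_monomial_mem_toricIdeal {k : Type*} [Field k] {d : ℕ} {ι : Type*} [Fintype ι]
    {A : Matrix (Fin d) ι ℤ} {s t : ι →₀ ℕ} (h : toricDegree A s = toricDegree A t) :
    MvPolynomial.monomial s (1 : k) - MvPolynomial.monomial t 1 ∈ toricIdeal k A := by
  rw [toricIdeal, RingHom.mem_ker, map_sub, aeval_monomial_eq_single_toricDegree,
    aeval_monomial_eq_single_toricDegree, h, sub_self]

/-- No homogeneous component of an element of the toric ideal is a single term. -/
theorem exists_ne_toricDegree_eq_of_mem_support {k : Type*} [Field k] {d : ℕ} {ι : Type*}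
    [Fintype ι] {A : Matrix (Fin d) ι ℤ} {f : MvPolynomial ι k} (hf : f ∈ toricIdeal k A)
    {s : ι →₀ ℕ} (hs : s ∈ f.support) : ∃ t, t ≠ s ∧ toricDegree A s = toricDegree A t := by
  classical
  by_contra! hne
  rw [toricIdeal, RingHom.mem_ker, f.as_sum, map_sum] at hf
  simp only [aeval_monomial_eq_single_toricDegree] at hf
  rw [← Finset.add_sum_erase _ _ hs] at hf
  -- By assumption every other exponent has a different degree, so only the term at `s` contributes
  -- in the degree of `s`.
  have h0 : ∑ t ∈ f.support.erase s, (AddMonoidAlgebra.single (toricDegree A t) (f.coeff t) :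
      AddMonoidAlgebra k (Fin d → ℤ)).coeff (toricDegree A s) = 0 := by
    refine Finset.sum_eq_zero fun t ht => ?_
    rw [AddMonoidAlgebra.coeff_single, Finsupp.single_apply,
      if_neg (hne t (Finset.ne_of_mem_erase ht)).symm]
  have h1 := congrArg (fun p => p.coeff (toricDegree A s)) hf
  simp only [AddMonoidAlgebra.coeff_add, AddMonoidAlgebra.coeff_sum, Finsupp.add_apply,
    Finsupp.finsetSum_apply, AddMonoidAlgebra.coeff_zero, Finsupp.zero_apply] at h1
  rw [h0, add_zero, AddMonoidAlgebra.coeff_single, Finsupp.single_eq_same] at h1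
  exact MvPolynomial.mem_support_iff.1 hs h1

/-- For a homogeneous configuration, monomials of equal degree in the grading by `A` have equal
total degree. -/
theorem IsHomogeneousConfig.sum_eq {d : ℕ} {ι : Type*} [Fintype ι] {A : Matrix (Fin d) ι ℤ}
    (hA : IsHomogeneousConfig A) {s t : ι →₀ ℕ} (h : toricDegree A s = toricDegree A t) :
    ∑ i, s i = ∑ i, t i := by
  obtain ⟨w, hw⟩ := hA
  -- Pairing with `w` sends each column to 1, so it recovers the total degree from `toricDegree`.
  have key : ∀ s : ι →₀ ℕ, ∑ j, w j * (toricDegree A s j : ℝ) = ∑ i, (s i : ℝ) := by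
    intro s
    simp only [toricDegree, Finset.sum_apply, Pi.smul_apply]
    simp only [nsmul_eq_mul, Int.cast_sum, Int.cast_mul, Int.cast_natCast, Finset.mul_sum]
    rw [Finset.sum_comm]
    refine Finset.sum_congr rfl fun i _ => ?_
    refine Eq.trans ?_ (mul_one (s i : ℝ))
    rw [← hw i, Finset.mul_sum]
    exact Finset.sum_congr rfl fun j _ => by ring
  have := key s
  rw [h, key t] at this
  exact_mod_cast this.symm

/-- Every variable is the greatest one for some lexicographic term order. -/
theorem exists_lexTermOrder_lt {ι : Type*} [Finite ι] (j : ι) :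
    ∃ o : LinearOrder ι, ∀ s t : ι →₀ ℕ, t j < s j → t ≺[lexTermOrder o] s := by
  classical
  obtain ⟨n, ⟨e⟩⟩ := Finite.exists_equiv_fin ι
  -- `MonomialOrder.lex` compares the least index first, so the greatest variable needs the least
  -- rank: 0 is kept for `j`, and the shift by one keeps `r` injective.
  let r : ι → ℕ := fun i => if i = j then 0 else (e i : ℕ) + 1
  have hr : Function.Injective r := by
    intro a b hab
    simp only [r] at hab
    split_ifs at hab with ha hb
    · rw [ha, hb]
    · exact e.injective (Fin.ext (by omega))
  let o : LinearOrder ι := LinearOrder.lift' r hr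
  refine ⟨o, fun s t hst => ?_⟩
  have : toLex t < toLex s := by
    rw [Finsupp.Lex.lt_iff]
    refine ⟨j, fun i hi => ?_, hst⟩
    have : r i < r j := hi
    simp [r] at this
  exact this

theorem degree_monomial_sub_monomial {σ k : Type*} [Field k] (m : MonomialOrder σ) {s t : σ →₀ ℕ}
    (h : t ≺[m] s) :
    m.degree (MvPolynomial.monomial s (1 : k) - MvPolynomial.monomial t 1) = s := by
  classical
  rw [m.degree_sub_of_lt, m.degree_monomial, if_neg one_ne_zero]
  rwa [m.degree_monomial, m.degree_monomial, if_neg one_ne_zero, if_neg one_ne_zero]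

/-- The leading monomial of a nonzero element of the ideal properly divides no term of an element
of the reduced Gröbner basis. -/
theorem IsReducedGroebnerBasis.not_degree_lt {σ k : Type*} [Field k] {m : MonomialOrder σ}
    {I : Ideal (MvPolynomial σ k)} {G : Set (MvPolynomial σ k)}
    (hG : IsReducedGroebnerBasis m I G) {f g : MvPolynomial σ k} (hf : f ∈ I) (hf0 : f ≠ 0)
    (hg : g ∈ G) {a : σ →₀ ℕ} (ha : a ∈ g.support) : ¬ m.degree f < a := by
  intro hlt
  obtain ⟨h, hh, hle⟩ := hG.exists_degree_le hf hf0
  have hha := hle.trans_lt hlt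
  by_cases hhg : h = g
  · subst hhg
    -- Reducedness does not cover `h` against itself, but no term of `h` exceeds its leading one.
    exact (m.le_degree ha).not_gt (m.toSyn_strictMono hha)
  · exact hG.reduced g hg h hh hhg a ha hha.le

/-- The ideal lies in the monomial ideal generated by all terms of members of `S`, where membership
is tested term by term. -/
theorem exists_mem_support_le_of_mem_span {σ k : Type*} [Field k] {S : Set (MvPolynomial σ k)}
    {p : MvPolynomial σ k} (hp : p ∈ Ideal.span S) {x : σ →₀ ℕ} (hx : x ∈ p.support) :
    ∃ f ∈ S, ∃ s ∈ f.support, s ≤ x := by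
  have hle : Ideal.span S ≤ Ideal.span ((fun s => MvPolynomial.monomial s (1 : k)) ''
      {s | ∃ f ∈ S, s ∈ f.support}) := by
    rw [Ideal.span_le]
    intro f hf
    rw [SetLike.mem_coe, MvPolynomial.mem_ideal_span_monomial_image]
    exact fun s hs => ⟨s, ⟨f, hf, hs⟩, le_rfl⟩
  obtain ⟨s, ⟨f, hf, hs⟩, hsx⟩ := MvPolynomial.mem_ideal_span_monomial_image.1 (hle hp) x hx
  exact ⟨f, hf, s, hs, hsx⟩

theorem mainTheorem3 {k : Type*} [Field k] {d : ℕ} {ι : Type*} [Fintype ι]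
    (A : Matrix (Fin d) ι ℤ) (hA : IsHomogeneousConfig A) (x : ι →₀ ℕ)
    (hx : ∀ o : LinearOrder ι,
      ∃ g ∈ reducedGroebnerBasis (lexTermOrder o) (toricIdeal k A), x ∈ g.support) :
    IsIndispensableMonomial k A x := by
  classical
  have hmin : ∀ s t : ι →₀ ℕ, t ≠ s → toricDegree A s = toricDegree A t → ¬ s < x := by
    intro s t hts hdeg
    obtain ⟨j, hj⟩ : ∃ j, t j < s j := by
      by_contra! hle
      -- A pointwise inequality between vectors of equal sum is an equality.
      have := (Finset.sum_eq_sum_iff_of_le fun i _ => hle i).1 (hA.sum_eq hdeg)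
      exact hts (Finsupp.ext fun i => (this i (Finset.mem_univ i)).symm)
    obtain ⟨o, ho⟩ := exists_lexTermOrder_lt j
    obtain ⟨g, hg, hxg⟩ := hx o
    have hf0 : MvPolynomial.monomial s (1 : k) - MvPolynomial.monomial t 1 ≠ 0 := by
      rw [sub_ne_zero]
      exact fun h => hts (MvPolynomial.monomial_left_injective one_ne_zero h).symm
    have := (reducedGroebnerBasis_spec _ _).not_degree_lt
      (monomial_sub_monomial_mem_toricIdeal hdeg) hf0 hg hxg
    rwa [degree_monomial_sub_monomial _ (ho s t hj)] at this
  intro S hS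
  obtain ⟨y, hyx, hdeg⟩ : ∃ y, y ≠ x ∧ toricDegree A x = toricDegree A y := by
    obtain ⟨n, ⟨e⟩⟩ := Finite.exists_equiv_fin ι
    -- Any ordering of the variables serves here: only `g ∈ toricIdeal k A` is used.
    obtain ⟨g, hg, hxg⟩ := hx (LinearOrder.lift' e e.injective)
    exact exists_ne_toricDegree_eq_of_mem_support ((reducedGroebnerBasis_spec _ _).subset hg) hxg
  have hp := monomial_sub_monomial_mem_toricIdeal (k := k) hdeg
  rw [← hS.span_eq] at hp
  have hxp : x ∈ (MvPolynomial.monomial x (1 : k) - MvPolynomial.monomial y 1).support := by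
    rw [MvPolynomial.mem_support_iff, MvPolynomial.coeff_sub, MvPolynomial.coeff_monomial,
      MvPolynomial.coeff_monomial, if_pos rfl, if_neg hyx, sub_zero]
    exact one_ne_zero
  obtain ⟨f, hf, s, hs, hsx⟩ := exists_mem_support_le_of_mem_span hp hxp
  have hfI : f ∈ toricIdeal k A := hS.span_eq ▸ Ideal.subset_span hf
  obtain ⟨t, hts, hst⟩ := exists_ne_toricDegree_eq_of_mem_support hfI hs
  have hsx' : s = x := hsx.eq_of_not_lt (hmin s t hts hst)
  exact ⟨f, hf, hsx' ▸ hs⟩
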